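/- Let $\mathrm K=[0,1]^2$, and for a distribution $T$ on $\mathbb R^2$ let $\|T\|_{\mathcal M}$ be the total variation of $T$ if $T$ is a bounded (finite signed Borel) measure supported in $\mathrm K$. Let $\mathrm D$ be the distributional derivative in one variable and $\mathrm I$ the identity. Let $\mathcal M_{\mathrm D\otimes\mathrm D,0}(\mathrm K)$ be the space of the distributions $f\in\mathcal D'(\mathbb R^2)$ such that $[\mathrm D\otimes\mathrm D]\{f\}$ is a bounded measure supported in $\mathrm K$ and such that $\langle f,\phi\rangle=0$ for all $\phi\in\mathcal C_c^\infty(\mathbb R^2\setminus\mathrm K)$. Its weak$^\star$ topology is the coarsest one for which all the functionals $f\mapsto\int\phi\,\mathrm d[\mathrm D\otimes\mathrm D]\{f\}$, $\phi\in\mathcal C_0(\mathbb R^2)$, are continuous. Let $\mathcal M^+_{\mathrm D\otimes\mathrm D,0}(\mathrm K)$ be the convex cone of its elements $f$ with $\langle f,\phi\rangle\ge0$ for all $\phi\in\mathcal C_c^\infty(\mathbb R^2)$, $\phi\ge0$. For $n\ge1$ let $\mathcal X_n=\{2^{-n}(i,j): i,j\in\{0,\dots,2^n\}\}$ be the dyadic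 grid, and let $\mathcal M^+_{\mathrm D\otimes\mathrm D,0}(\mathcal X_n)$ be the set of the $f\in\mathcal M^+_{\mathrm D\otimes\mathrm D,0}(\mathrm K)$ such that the measure $[\mathrm D\otimes\mathrm D]\{f\}$ is supported in $\mathcal X_n$. Let $\theta\in(0,1]$, $\lambda>0$, and $$\|f\|_\theta=\theta\,\|[\mathrm D\otimes\mathrm D]\{f\}\|_{\mathcal M}+(1-\theta)\bigl(\|[\mathrm I\otimes\mathrm D]\{f\}\|_{\mathcal M}+\|[\mathrm D\otimes\mathrm I]\{f\}\|_{\mathcal M}\bigr).$$ Let $y\in\mathbb R^M$. Let $E:\mathbb R^M\times\mathbb R^M\to[0,\infty]$ be such that $E(y,\cdot)$ is continuous (as a map into $[0,\infty]$), coercive (that is, $E(y,z)\to\infty$ as $\|z\|\to\infty$) and strictly convex on its effective domain $\{z:E(y,z)<\infty\}$. Let $\langle\cdot,\nu\rangle:\mathcal M^+_{\mathrm D\otimes\mathrm D,0}(\mathrm K)\to\mathbb R^M$ be linear (additive and positively homogeneous) and weak$^\star$ continuous. Let $$\mathcal J(f)=E(y,\langle f,\nu\rangle)+\lambda\|f\|_\theta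 ,$$ and assume that $\mathcal J$ is proper, that is, $E(y,\langle f,\nu\rangle)<\infty$ for at least one $f\in\mathcal M^+_{\mathrm D\otimes\mathrm D,0}(\mathrm K)$. Let $\mathcal V$ be the set of the minimisers of $\mathcal J$ over $\mathcal M^+_{\mathrm D\otimes\mathrm D,0}(\mathrm K)$ and, for $n\ge1$, let $\mathcal V_n$ be the set of the minimisers of $\mathcal J$ over $\mathcal M^+_{\mathrm D\otimes\mathrm D,0}(\mathcal X_n)$. Then, for any sequence $(f_n^\star)_{n\ge1}$ with $f_n^\star\in\mathcal V_n$ for all $n$, and for any $f^\star\in\mathcal V$, 1. $\lim_{n\to\infty}\mathcal J(f_n^\star)=\mathcal J(f^\star)$; 2. $\lim_{n\to\infty}\langle f_n^\star,\nu\rangle=\langle f^\star,\nu\rangle$. -/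

import Mathlib

open MeasureTheory Filter Topology TopologicalSpace
open scoped Distributions ZeroAtInfty LineDeriv ENNReal NNReal

noncomputable section

namespace MixedDeriv

/-- Real test functions of class `C_c^∞` on the plane `ℝ²`. -/
abbrev TestFn : Type := 𝓓((⊤ : Opens (ℝ × ℝ)), ℝ)

/-- Real distributions on the plane `ℝ²`. -/
abbrev Distr : Type := 𝓓'((⊤ : Opens (ℝ × ℝ)), ℝ)

/-- The distributional derivative `D ⊗ I`, with respect to the first variable. -/
def DI (f : Distr) : Distr := ∂_{((1 : ℝ), (0 : ℝ))} f

/-- The distributional derivative `I ⊗ D`, with respect to the second variable. -/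
def ID (f : Distr) : Distr := ∂_{((0 : ℝ), (1 : ℝ))} f

/-- The mixed distributional derivative `D ⊗ D`. -/
def DD (f : Distr) : Distr := DI (ID f)

/-- The unit square `K = [0,1] × [0,1]`. -/
def unitSquare : Set (ℝ × ℝ) := Set.Icc 0 1 ×ˢ Set.Icc 0 1

/-- The dyadic grid of the points `(i / 2^n, j / 2^n)` with `0 ≤ i, j ≤ 2^n`. -/
def dyadicGrid (n : ℕ) : Set (ℝ × ℝ) :=
  {x | ∃ i j : ℕ, i ≤ 2 ^ n ∧ j ≤ 2 ^ n ∧ x = ((i : ℝ) / 2 ^ n, (j : ℝ) / 2 ^ n)}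

/-- The distribution `T` is the bounded (finite signed Borel) measure `μ`, and `μ` is supported
in the closed set `S`. -/
def IsMeasureOn (S : Set (ℝ × ℝ)) (T : Distr) (μ : SignedMeasure (ℝ × ℝ)) : Prop :=
  μ.variation Sᶜ = 0 ∧ ∀ φ : TestFn, T φ = ∫ᵛ x, φ x ∂•μ

/-- The norm of a distribution in the space `M(K)` of bounded measures supported in `K`: the total
variation of the (unique) measure that it is, and `∞` if it is not such a measure. -/
def measureNorm (T : Distr) : ℝ≥0∞ :=
  ⨅ (μ : SignedMeasure (ℝ × ℝ)) (_ : IsMeasureOn unitSquare T μ), μ.variation Set.univ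

section Helpers

lemma DI_add (f g : Distr) : DI (f + g) = DI f + DI g := LineDeriv.lineDerivOp_add _ _ _

lemma ID_add (f g : Distr) : ID (f + g) = ID f + ID g := LineDeriv.lineDerivOp_add _ _ _

lemma DD_add (f g : Distr) : DD (f + g) = DD f + DD g := by
  rw [DD, ID_add, DI_add]; rfl

lemma DI_smul (c : ℝ) (f : Distr) : DI (c • f) = c • DI f := LineDeriv.lineDerivOp_smul _ _ _

lemma ID_smul (c : ℝ) (f : Distr) : ID (c • f) = c • ID f := LineDeriv.lineDerivOp_smul _ _ _

lemma DD_smul (c : ℝ) (f : Distr) : DD (c • f) = c • DD f := by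
  rw [DD, ID_smul, DI_smul]; rfl

lemma DD_zero : DD 0 = 0 := by
  have h := DD_smul 0 0
  simpa using h

lemma integrable_testFn (μ : SignedMeasure (ℝ × ℝ)) (φ : TestFn) :
    μ.Integrable (φ : ℝ × ℝ → ℝ) := by
  have : IsFiniteMeasure μ.variation := by
    rw [← SignedMeasure.totalVariation_eq_variation]
    unfold SignedMeasure.totalVariation
    infer_instance
  exact φ.continuous.integrable_of_hasCompactSupport φ.hasCompactSupport

lemma IsMeasureOn.zero (S : Set (ℝ × ℝ)) : IsMeasureOn S 0 0 := by
  refine ⟨by simp, fun φ => by simp⟩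

lemma IsMeasureOn.add {S : Set (ℝ × ℝ)} {T U : Distr} {μ ν : SignedMeasure (ℝ × ℝ)}
    (hT : IsMeasureOn S T μ) (hU : IsMeasureOn S U ν) : IsMeasureOn S (T + U) (μ + ν) := by
  refine ⟨?_, fun φ => ?_⟩
  · have h := VectorMeasure.variation_add_le (μ := μ) (ν := ν) Sᶜ
    simpa [hT.1, hU.1] using h
  · have h := VectorMeasure.integral_add_vectorMeasure (B := ContinuousLinearMap.lsmul ℝ ℝ)
      (integrable_testFn μ φ) (integrable_testFn ν φ)
    rw [h, ← hT.2, ← hU.2]; rfl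

lemma IsMeasureOn.smul {S : Set (ℝ × ℝ)} {T : Distr} {μ : SignedMeasure (ℝ × ℝ)} (c : ℝ)
    (hT : IsMeasureOn S T μ) : IsMeasureOn S (c • T) (c • μ) := by
  refine ⟨?_, fun φ => ?_⟩
  · simp [VectorMeasure.variation_smul, hT.1]
  · rw [VectorMeasure.integral_smul_vectorMeasure, ← hT.2]; rfl

end Helpers

/-- The native space `M_{D⊗D,0}(K)`: the distributions `f` on `ℝ²` whose mixed derivative is a
bounded measure supported in `K`, and that vanish on the complement of `K`. -/
def nativeSpace : Submodule ℝ Distr where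
  carrier := {f | (∃ μ, IsMeasureOn unitSquare (DD f) μ) ∧
    ∀ φ : TestFn, tsupport φ ⊆ unitSquareᶜ → f φ = 0}
  add_mem' := by
    rintro f g ⟨⟨μ, hμ⟩, hf⟩ ⟨⟨ν, hν⟩, hg⟩
    refine ⟨⟨μ + ν, by rw [DD_add]; exact hμ.add hν⟩, fun φ hφ => ?_⟩
    change f φ + g φ = 0
    rw [hf φ hφ, hg φ hφ, add_zero]
  zero_mem' := ⟨⟨0, by rw [DD_zero]; exact IsMeasureOn.zero _⟩, fun _ _ => rfl⟩
  smul_mem' := by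
    rintro c f ⟨⟨μ, hμ⟩, hf⟩
    refine ⟨⟨c • μ, by rw [DD_smul]; exact hμ.smul c⟩, fun φ hφ => ?_⟩
    change c * f φ = 0
    rw [hf φ hφ, mul_zero]

/-- The convex cone `M⁺_{D⊗D,0}(K)` of the positive elements of the native space. -/
def positiveCone : Submodule ℝ≥0 nativeSpace where
  carrier := {f | ∀ φ : TestFn, (∀ x, 0 ≤ φ x) → 0 ≤ (f : Distr) φ}
  add_mem' := by
    intro f g hf hg φ hφ
    change 0 ≤ (f : Distr) φ + (g : Distr) φ
    exact add_nonneg (hf φ hφ) (hg φ hφ)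
  zero_mem' := fun _ _ => le_rfl
  smul_mem' := by
    intro c f hf φ hφ
    change 0 ≤ (c : ℝ) * (f : Distr) φ
    exact mul_nonneg c.2 (hf φ hφ)

/-- The elements of `M⁺_{D⊗D,0}(K)` whose mixed derivative is supported in the dyadic grid of
level `n`. -/
def gridCone (n : ℕ) : Set positiveCone :=
  {f | ∃ μ, IsMeasureOn (dyadicGrid n) (DD ((f : nativeSpace) : Distr)) μ}

/-- The mixed derivative of an element of the native space, as a measure. -/
def mixedMeasure (f : nativeSpace) : SignedMeasure (ℝ × ℝ) := f.2.1.choose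

/-- The pairing `⟨f, [D ⊗ D]φ⟩ = ∫ φ d([D ⊗ D]f)` of an element `f` of the native space with the
element `[D ⊗ D]φ`, `φ ∈ C₀(ℝ²)`, of its predual. -/
def predualPairing (f : nativeSpace) (φ : C₀(ℝ × ℝ, ℝ)) : ℝ :=
  ∫ᵛ x, φ x ∂•(mixedMeasure f)

/-- The weak-* topology of the native space: the coarsest topology for which all the
functionals `f ↦ ⟨f, [D ⊗ D]φ⟩`, `φ ∈ C₀(ℝ²)`, are continuous. -/
@[reducible]
def weakStarTopology : TopologicalSpace nativeSpace :=
  TopologicalSpace.induced predualPairing Pi.topologicalSpace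

/-- Weak-* continuity of a map that is defined on the cone `M⁺_{D⊗D,0}(K)`. -/
def WeakStarContinuous {Y : Type*} [TopologicalSpace Y] (g : positiveCone → Y) : Prop :=
  Continuous[weakStarTopology.induced Subtype.val, inferInstance] g

/-- The norm
`‖f‖_θ = θ ‖[D ⊗ D]f‖_M + (1 - θ) (‖[I ⊗ D]f‖_M + ‖[D ⊗ I]f‖_M)`, with values in `[0, ∞]`. -/
def thetaNorm (θ : ℝ) (f : Distr) : ℝ≥0∞ :=
  ENNReal.ofReal θ * measureNorm (DD f) +
    ENNReal.ofReal (1 - θ) * (measureNorm (ID f) + measureNorm (DI f))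

/-- Strict convexity of a function with values in `[0, ∞]`, that is, on its effective domain. -/
def StrictlyConvex {V : Type*} [AddCommGroup V] [Module ℝ V] (g : V → ℝ≥0∞) : Prop :=
  ∀ z w : V, z ≠ w → g z ≠ ∞ → g w ≠ ∞ → ∀ t : ℝ, 0 < t → t < 1 →
    g (t • z + (1 - t) • w) < ENNReal.ofReal t * g z + ENNReal.ofReal (1 - t) * g w

/-- Coercivity: `g z → ∞` as `‖z‖ → ∞`. -/
def Coercive {V : Type*} [NormedAddCommGroup V] (g : V → ℝ≥0∞) : Prop :=
  Tendsto g (comap norm atTop) (𝓝 ∞)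

/-- The loss functional `J(f) = E(y, ⟨f, ν⟩) + λ ‖f‖_θ`, with values in `[0, ∞]`. -/
def loss {M : ℕ} (E : EuclideanSpace ℝ (Fin M) → EuclideanSpace ℝ (Fin M) → ℝ≥0∞)
    (y : EuclideanSpace ℝ (Fin M)) (ν : positiveCone →ₗ[ℝ≥0] EuclideanSpace ℝ (Fin M))
    (lam θ : ℝ) (f : positiveCone) : ℝ≥0∞ :=
  E y (ν f) + ENNReal.ofReal lam * thetaNorm θ ((f : nativeSpace) : Distr)

/-- The set of the minimisers of `J` over a set `C`. -/
def argmin {X : Type*} (J : X → ℝ≥0∞) (C : Set X) : Set X := {f | f ∈ C ∧ ∀ g ∈ C, J f ≤ J g}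

end MixedDeriv

end

/-! The heart of the matter is a discretisation that stays in the positive cone, moves `[D ⊗ D]f`
onto the grid, and costs almost nothing in norm. With `N = 2 ^ n`, replace `f` by the piecewise
constant function whose value on each cell is the mean of `f` against a smooth unit-mass bump in
that cell. A hat function is a running integral of the bump, so summation by parts turns each
derivative of the approximant into the same kind of sampling of that derivative of `f`, with hats
for bumps and nodes for cells (`ID_approx`, `DI_approx`, `DD_approx`). The hats sum to one on
`[0,1]` and the bumps to at most `1 + ε`, so every norm grows by at most the factor `1 + ε`
(`thetaNorm_approx_le`).

The pairing of the new mixed derivative with `φ` is `DD f` applied to a quasi-interpolant of `φ`.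
These converge to `φ` uniformly on the square, which gives weak-* convergence
(`tendsto_coneApprox`). Comparing the grid minimisers with the approximants of `fstar`, as `ε → 0`,
proves the first claim (`tendsto_loss_of_mem_argmin`).

For the second claim, coercivity keeps the measurements bounded along any subsequence. A cluster
point other than `ν fstar` would, by strict convexity of `E y` and convexity of the norm, let
midpoints with `fstar` beat the minimum (`eq_of_tendsto_minimising`). -/

noncomputable section

namespace MixedDeriv

/-! ### One-variable bumps and hats. -/

/-- A smooth bump `b` of unit mass in the interior of `[0,1]` with `b ≤ 1 + ε`, together with the
smooth hat function `h t = ∫_t^{t+1} b`. -/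
structure Profile (ε : ℝ) where
  b : ℝ → ℝ
  margin : ℝ
  margin_pos : 0 < margin
  contDiff_b : ContDiff ℝ ((⊤ : ℕ∞) : WithTop ℕ∞) b
  b_nonneg : ∀ t, 0 ≤ b t
  b_le : ∀ t, b t ≤ 1 + ε
  supp : ∀ t, b t ≠ 0 → margin ≤ t ∧ t ≤ 1 - margin
  integral_b : ∫ t, b t = 1

lemma Profile.exists {ε : ℝ} (hε : 0 < ε) : Nonempty (Profile ε) := by
  have h1 : 1 / (2 * (1 + ε)) < 1 / 2 := by
    rw [div_lt_div_iff₀ (by positivity) (by positivity)]; linarith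
  -- The normalised bump is at most the inverse length of its inner ball, so `rIn` is chosen to make
  -- `1 / (2 * rIn) = 1 + ε`. Any outer radius strictly between `rIn` and `1 / 2` leaves a positive
  -- margin.
  let B : ContDiffBump (1 / 2 : ℝ) :=
    { rIn := 1 / (2 * (1 + ε))
      rOut := (1 / (2 * (1 + ε)) + 1 / 2) / 2
      rIn_pos := by positivity
      rIn_lt_rOut := by linarith }
  refine ⟨⟨B.normed volume, 1 / 2 - B.rOut, ?_, B.contDiff_normed, B.nonneg_normed, fun t => ?_,
    fun t ht => ?_, B.integral_normed⟩⟩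
  · change 0 < 1 / 2 - (1 / (2 * (1 + ε)) + 1 / 2) / 2
    linarith
  · refine (B.normed_le_div_measure_closedBall_rIn volume t).trans (le_of_eq ?_)
    rw [Real.volume_real_closedBall B.rIn_pos.le]
    change 1 / (2 * (1 / (2 * (1 + ε)))) = 1 + ε
    have : (1 + ε) ≠ 0 := by positivity
    field_simp
  · have : t ∈ Metric.ball (1 / 2 : ℝ) B.rOut := by
      rw [← B.support_normed_eq (μ := volume)]; exact ht
    rw [Metric.mem_ball, Real.dist_eq, abs_lt] at this
    constructor <;> linarith

namespace Profile

variable {ε : ℝ} (k : Profile ε)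

/-- The smooth hat function of a profile. -/
def h (t : ℝ) : ℝ := ∫ s in t..(t + 1), k.b s

lemma intervalIntegrable_b (s t : ℝ) : IntervalIntegrable k.b volume s t :=
  k.contDiff_b.continuous.intervalIntegrable s t

lemma h_nonneg (t : ℝ) : 0 ≤ k.h t :=
  intervalIntegral.integral_nonneg_of_forall (by linarith) k.b_nonneg

lemma h_supp (t : ℝ) (ht : k.h t ≠ 0) : |t| ≤ 1 := by
  by_contra! hlt
  refine ht ?_
  have : ∀ s ∈ Set.uIcc t (t + 1), k.b s = 0 := by
    intro s hs
    rw [Set.uIcc_of_le (by linarith)] at hs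
    by_contra hne
    have h1 := k.supp s hne
    have h2 := k.margin_pos
    rcases lt_abs.1 hlt with h3 | h3 <;> linarith [hs.1, hs.2]
  rw [h, intervalIntegral.integral_congr (g := fun _ => (0 : ℝ)) this]
  simp

/-- The derivative of a hat is a difference of two neighbouring bumps: this is what makes sampling
commute with differentiation. -/
lemma hasDerivAt_h (t : ℝ) : HasDerivAt k.h (k.b (t + 1) - k.b t) t := by
  have hB : ∀ s, HasDerivAt (fun u => ∫ x in (0 : ℝ)..u, k.b x) (k.b s) s := fun s =>
    k.contDiff_b.continuous.integral_hasStrictDerivAt 0 s |>.hasDerivAt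
  have : k.h = fun u => (∫ x in (0 : ℝ)..(u + 1), k.b x) - ∫ x in (0 : ℝ)..u, k.b x := by
    ext u
    rw [intervalIntegral.integral_interval_sub_left (k.intervalIntegrable_b _ _)
      (k.intervalIntegrable_b _ _), h]
  rw [this]
  exact ((hB (t + 1)).comp_add_const t 1).sub (hB t)

lemma contDiff_h : ContDiff ℝ ((⊤ : ℕ∞) : WithTop ℕ∞) k.h := by
  rw [contDiff_infty_iff_deriv]
  refine ⟨fun t => (k.hasDerivAt_h t).differentiableAt, ?_⟩
  have : deriv k.h = fun t => k.b (t + 1) - k.b t := funext fun t => (k.hasDerivAt_h t).deriv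
  rw [this]
  exact (k.contDiff_b.comp (contDiff_id.add contDiff_const)).sub k.contDiff_b

/-- The integration intervals of consecutive hats are adjacent, so the sum telescopes to one
integral over `[t - N, t + 1]`, which contains `[0, 1]` and hence all the mass of `b`. -/
lemma sum_h (N : ℕ) {t : ℝ} (h0 : 0 ≤ t) (h1 : t ≤ N) :
    ∑ i ∈ Finset.range (N + 1), k.h (t - i) = 1 := by
  have key : ∀ n : ℕ, ∑ i ∈ Finset.range n, k.h (t - i) = ∫ s in (t - n + 1)..(t + 1), k.b s := by
    intro n
    induction n with
    | zero => simp
    | succ n ih =>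
      rw [Finset.sum_range_succ, ih, h, add_comm, intervalIntegral.integral_add_adjacent_intervals
        (k.intervalIntegrable_b _ _) (k.intervalIntegrable_b _ _)]
      congr 1; push_cast; ring
  rw [key, intervalIntegral.integral_eq_integral_of_support_subset, k.integral_b]
  intro s hs
  have h2 := k.supp s hs
  have h3 := k.margin_pos
  push_cast
  constructor <;> linarith [h2.1, h2.2]

/-- The integer translates of `b` have disjoint supports, so at most one term is nonzero. -/
lemma sum_b_le (hε : 0 ≤ ε) (N : ℕ) (t : ℝ) :
    ∑ i ∈ Finset.range N, k.b (t - i) ≤ 1 + ε := by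
  by_cases hex : ∃ i ∈ Finset.range N, k.b (t - i) ≠ 0
  · obtain ⟨i, hi, hne⟩ := hex
    rw [Finset.sum_eq_single_of_mem i hi]
    · exact k.b_le _
    · intro j _ hji
      by_contra hj
      have h1 := k.supp _ hne
      have h2 := k.supp _ hj
      have h3 := k.margin_pos
      have h4 : (j : ℝ) < i + 1 := by linarith [h1.1, h1.2, h2.1, h2.2]
      have h5 : (i : ℝ) < j + 1 := by linarith [h1.1, h1.2, h2.1, h2.2]
      norm_cast at h4 h5
      omega
  · push Not at hex
    rw [Finset.sum_eq_zero hex]; linarith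

variable (N : ℕ) [NeZero N]

lemma natCast_pos_of_neZero : (0 : ℝ) < N := by exact_mod_cast Nat.pos_of_neZero N

/-- The scaled bump `t ↦ b (N t - i)`. -/
def bump (i : ℤ) : 𝓓((⊤ : Opens ℝ), ℝ) where
  toFun t := k.b (N * t - i)
  contDiff' := k.contDiff_b.comp ((contDiff_const.mul contDiff_id).sub contDiff_const)
  hasCompactSupport' := by
    refine HasCompactSupport.of_support_subset_isCompact
      (isCompact_Icc (a := (i : ℝ) / N) (b := (i + 1 : ℝ) / N)) fun t ht => ?_
    have h1 := k.supp _ ht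
    have h2 := k.margin_pos
    have h3 := natCast_pos_of_neZero N
    constructor
    · rw [div_le_iff₀ h3]; linarith
    · rw [le_div_iff₀ h3]; linarith
  tsupport_subset' := by simp

/-- The scaled hat function `t ↦ h (N t - i)`. -/
def hat (i : ℤ) : 𝓓((⊤ : Opens ℝ), ℝ) where
  toFun t := k.h (N * t - i)
  contDiff' := k.contDiff_h.comp ((contDiff_const.mul contDiff_id).sub contDiff_const)
  hasCompactSupport' := by
    refine HasCompactSupport.of_support_subset_isCompact
      (isCompact_Icc (a := (i - 1 : ℝ) / N) (b := (i + 1 : ℝ) / N)) fun t ht => ?_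
    have h1 := abs_le.1 (k.h_supp _ ht)
    have h3 := natCast_pos_of_neZero N
    constructor
    · rw [div_le_iff₀ h3]; linarith
    · rw [le_div_iff₀ h3]; linarith
  tsupport_subset' := by simp

lemma bump_apply (i : ℤ) (t : ℝ) : k.bump N i t = k.b (N * t - i) := rfl

lemma hat_apply (i : ℤ) (t : ℝ) : k.hat N i t = k.h (N * t - i) := rfl

lemma hasDerivAt_hat (i : ℤ) (t : ℝ) :
    HasDerivAt (k.hat N i) (N * (k.bump N (i - 1) t - k.bump N i t)) t := by
  have h1 : HasDerivAt (fun t : ℝ => (N : ℝ) * t - i) N t := by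
    simpa using ((hasDerivAt_id t).const_mul (N : ℝ)).sub_const (i : ℝ)
  have h2 := (k.hasDerivAt_h (N * t - i)).comp t h1
  refine h2.congr_deriv ?_
  rw [bump_apply, bump_apply, mul_comm]
  push_cast
  congr 3
  ring

lemma sum_hat {t : ℝ} (ht : t ∈ Set.Icc (0 : ℝ) 1) :
    ∑ i ∈ Finset.range (N + 1), k.hat N i t = 1 := by
  have h3 := natCast_pos_of_neZero N
  simpa [hat_apply] using k.sum_h N (t := N * t) (mul_nonneg h3.le ht.1)
    (mul_le_of_le_one_right h3.le ht.2)

lemma sum_bump_le (hε : 0 ≤ ε) (t : ℝ) : ∑ i ∈ Finset.range N, k.bump N i t ≤ 1 + ε := by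
  simpa [bump_apply] using k.sum_b_le hε N (N * t)

end Profile

/-! ### Tensor test functions, integration by parts, and vanishing off the square. -/

/-- The tensor product of two test functions of one variable. -/
def tensor (u v : 𝓓((⊤ : Opens ℝ), ℝ)) : TestFn where
  toFun x := u x.1 * v x.2
  contDiff' := (u.contDiff.comp contDiff_fst).mul (v.contDiff.comp contDiff_snd)
  hasCompactSupport' := by
    refine HasCompactSupport.of_support_subset_isCompact
      (u.hasCompactSupport.isCompact.prod v.hasCompactSupport.isCompact) fun x hx => ?_
    exact ⟨subset_tsupport _ (left_ne_zero_of_mul hx), subset_tsupport _ (right_ne_zero_of_mul hx)⟩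
  tsupport_subset' := by simp

lemma tensor_apply (u v : 𝓓((⊤ : Opens ℝ), ℝ)) (x : ℝ × ℝ) : tensor u v x = u x.1 * v x.2 := rfl

lemma differentiable_testFn (φ : TestFn) : Differentiable ℝ φ :=
  φ.contDiff.differentiable (by simp)

lemma hasDerivAt_fst (φ : TestFn) (x : ℝ × ℝ) :
    HasDerivAt (fun t => φ (t, x.2)) ((∂_{((1 : ℝ), (0 : ℝ))} φ) x) x.1 := by
  have h1 : HasDerivAt (fun t : ℝ => (t, x.2)) ((1 : ℝ), (0 : ℝ)) x.1 :=
    (hasDerivAt_id _).prodMk (hasDerivAt_const _ _)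
  have h2 := (differentiable_testFn φ x).hasFDerivAt.comp_hasDerivAt x.1 h1
  refine h2.congr_deriv ?_
  rw [TestFunction.lineDerivOp_eq_lineDerivCLM (𝕜 := ℝ), TestFunction.lineDerivCLM_apply_of_le
    (by simp), (differentiable_testFn φ x).lineDeriv_eq_fderiv]

lemma hasDerivAt_snd (φ : TestFn) (x : ℝ × ℝ) :
    HasDerivAt (fun t => φ (x.1, t)) ((∂_{((0 : ℝ), (1 : ℝ))} φ) x) x.2 := by
  have h1 : HasDerivAt (fun t : ℝ => (x.1, t)) ((0 : ℝ), (1 : ℝ)) x.2 :=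
    (hasDerivAt_const _ _).prodMk (hasDerivAt_id _)
  have h2 := (differentiable_testFn φ x).hasFDerivAt.comp_hasDerivAt x.2 h1
  refine h2.congr_deriv ?_
  rw [TestFunction.lineDerivOp_eq_lineDerivCLM (𝕜 := ℝ), TestFunction.lineDerivCLM_apply_of_le
    (by simp), (differentiable_testFn φ x).lineDeriv_eq_fderiv]

lemma DI_apply (f : Distr) (φ : TestFn) : DI f φ = -f (∂_{((1 : ℝ), (0 : ℝ))} φ) := by
  rw [DI, Distribution.lineDerivOp_apply_apply, map_neg]

lemma ID_apply (f : Distr) (φ : TestFn) : ID f φ = -f (∂_{((0 : ℝ), (1 : ℝ))} φ) := by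
  rw [ID, Distribution.lineDerivOp_apply_apply, map_neg]

section Derivatives

variable {ε : ℝ} (k : Profile ε) (N : ℕ) [NeZero N]

lemma DI_tensor_hat (f : Distr) (i : ℤ) (v : 𝓓((⊤ : Opens ℝ), ℝ)) :
    DI f (tensor (k.hat N i) v) =
      N * (f (tensor (k.bump N i) v) - f (tensor (k.bump N (i - 1)) v)) := by
  have : ∂_{((1 : ℝ), (0 : ℝ))} (tensor (k.hat N i) v) =
      (N : ℝ) • (tensor (k.bump N (i - 1)) v - tensor (k.bump N i) v) := by
    ext x
    refine (hasDerivAt_fst (tensor (k.hat N i) v) x).unique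
      (((k.hasDerivAt_hat N i x.1).mul_const (v x.2)).congr_deriv ?_)
    change _ = (N : ℝ) * (k.bump N (i - 1) x.1 * v x.2 - k.bump N i x.1 * v x.2)
    ring
  rw [DI_apply, this, map_smul, map_sub, smul_eq_mul]
  ring

lemma ID_tensor_hat (f : Distr) (i : ℤ) (u : 𝓓((⊤ : Opens ℝ), ℝ)) :
    ID f (tensor u (k.hat N i)) =
      N * (f (tensor u (k.bump N i)) - f (tensor u (k.bump N (i - 1)))) := by
  have : ∂_{((0 : ℝ), (1 : ℝ))} (tensor u (k.hat N i)) =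
      (N : ℝ) • (tensor u (k.bump N (i - 1)) - tensor u (k.bump N i)) := by
    ext x
    refine (hasDerivAt_snd (tensor u (k.hat N i)) x).unique
      (((k.hasDerivAt_hat N i x.2).const_mul (u x.1)).congr_deriv ?_)
    change _ = (N : ℝ) * (u x.1 * k.bump N (i - 1) x.2 - u x.1 * k.bump N i x.2)
    ring
  rw [ID_apply, this, map_smul, map_sub, smul_eq_mul]
  ring

/-- The distribution `f` vanishes on the complement of the unit square. -/
def VanishesOff (f : Distr) : Prop := ∀ φ : TestFn, tsupport φ ⊆ unitSquareᶜ → f φ = 0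

lemma VanishesOff.of_support {f : Distr} (hf : VanishesOff f) {φ : TestFn} {C : Set (ℝ × ℝ)}
    (hC : IsClosed C) (hCK : C ⊆ unitSquareᶜ) (hφ : ∀ x, φ x ≠ 0 → x ∈ C) : f φ = 0 :=
  hf φ ((closure_minimal hφ hC).trans hCK)

/-- Differentiation is local. This is needed because the mixed derivative is reached by a second
summation by parts, applied to `ID f`. -/
lemma VanishesOff.ID {f : Distr} (hf : VanishesOff f) : VanishesOff (ID f) := by
  intro φ hφ
  rw [ID_apply, hf.of_support (isClosed_tsupport φ) hφ, neg_zero]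
  intro x hx
  by_contra hxs
  refine hx ((hasDerivAt_snd φ x).unique ?_)
  have h1 : (φ : ℝ × ℝ → ℝ) =ᶠ[𝓝 x] 0 := notMem_tsupport_iff_eventuallyEq.1 hxs
  have h2 : Tendsto (fun t : ℝ => (x.1, t)) (𝓝 x.2) (𝓝 x) := by
    have : Continuous fun t : ℝ => (x.1, t) := by fun_prop
    exact this.tendsto x.2
  exact (hasDerivAt_const x.2 (0 : ℝ)).congr_of_eventuallyEq (h2.eventually h1)

/-- The indices `-1` and `N` are ghost cells just outside `[0,1]`. The margin of the profile keeps
their bumps at positive distance from it, so `f` gives zero there and summation by parts has no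
boundary terms. -/
lemma bump_ne_zero_neg_one {t : ℝ} (ht : k.bump N (-1) t ≠ 0) : t ≤ -(k.margin / N) := by
  have h1 := (k.supp _ ht).2
  have h3 := Profile.natCast_pos_of_neZero N
  rw [← neg_div, le_div_iff₀ h3]
  push_cast at h1
  linarith

lemma bump_ne_zero_self {t : ℝ} (ht : k.bump N N t ≠ 0) : 1 + k.margin / N ≤ t := by
  have h1 := (k.supp _ ht).1
  have h3 := Profile.natCast_pos_of_neZero N
  rw [← sub_nonneg]
  have : t - (1 + k.margin / N) = (N * t - N - k.margin) / N := by field_simp; ring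
  rw [this]
  push_cast at h1
  exact div_nonneg (by linarith) h3.le

lemma VanishesOff.tensor_bump_neg_one {f : Distr} (hf : VanishesOff f)
    (u : 𝓓((⊤ : Opens ℝ), ℝ)) : f (tensor u (k.bump N (-1))) = 0 := by
  have h3 : 0 < k.margin / N := div_pos k.margin_pos (Profile.natCast_pos_of_neZero N)
  refine hf.of_support (C := {x | x.2 ≤ -(k.margin / N)})
    (isClosed_le continuous_snd continuous_const) ?_ fun x hx =>
      bump_ne_zero_neg_one k N (right_ne_zero_of_mul hx)
  rintro x hx ⟨-, h, -⟩
  simp only [Set.mem_ofPred_eq] at hx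
  linarith

lemma VanishesOff.tensor_bump_self {f : Distr} (hf : VanishesOff f)
    (u : 𝓓((⊤ : Opens ℝ), ℝ)) : f (tensor u (k.bump N N)) = 0 := by
  have h3 : 0 < k.margin / N := div_pos k.margin_pos (Profile.natCast_pos_of_neZero N)
  refine hf.of_support (C := {x | 1 + k.margin / N ≤ x.2})
    (isClosed_le continuous_const continuous_snd) ?_ fun x hx =>
      bump_ne_zero_self k N (right_ne_zero_of_mul hx)
  rintro x hx ⟨-, -, h⟩
  simp only [Set.mem_ofPred_eq] at hx
  linarith

lemma VanishesOff.bump_neg_one_tensor {f : Distr} (hf : VanishesOff f)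
    (u : 𝓓((⊤ : Opens ℝ), ℝ)) : f (tensor (k.bump N (-1)) u) = 0 := by
  have h3 : 0 < k.margin / N := div_pos k.margin_pos (Profile.natCast_pos_of_neZero N)
  refine hf.of_support (C := {x | x.1 ≤ -(k.margin / N)})
    (isClosed_le continuous_fst continuous_const) ?_ fun x hx =>
      bump_ne_zero_neg_one k N (left_ne_zero_of_mul hx)
  rintro x hx ⟨⟨h, -⟩, -⟩
  simp only [Set.mem_ofPred_eq] at hx
  linarith

lemma VanishesOff.bump_self_tensor {f : Distr} (hf : VanishesOff f)
    (u : 𝓓((⊤ : Opens ℝ), ℝ)) : f (tensor (k.bump N N) u) = 0 := by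
  have h3 : 0 < k.margin / N := div_pos k.margin_pos (Profile.natCast_pos_of_neZero N)
  refine hf.of_support (C := {x | 1 + k.margin / N ≤ x.1})
    (isClosed_le continuous_const continuous_fst) ?_ fun x hx =>
      bump_ne_zero_self k N (left_ne_zero_of_mul hx)
  rintro x hx ⟨⟨-, h⟩, -⟩
  simp only [Set.mem_ofPred_eq] at hx
  linarith

end Derivatives

/-! ### Derivatives of product measures. -/

/-- A finite measure on the plane, as a distribution. -/
def ofMeasure (m : Measure (ℝ × ℝ)) : Distr :=
  (TestFunction.integralAgainstBilinCLM (ContinuousLinearMap.lsmul ℝ ℝ) m fun _ => (1 : ℝ) :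
    TestFn →L[ℝ] ℝ)

lemma ofMeasure_apply (m : Measure (ℝ × ℝ)) [IsFiniteMeasure m] (φ : TestFn) :
    ofMeasure m φ = ∫ x, φ x ∂m := by
  have h : LocallyIntegrableOn (fun _ : ℝ × ℝ => (1 : ℝ)) ((⊤ : Opens (ℝ × ℝ)) : Set (ℝ × ℝ)) m :=
    (locallyIntegrable_const _).locallyIntegrableOn _
  refine (TestFunction.integralAgainstBilinCLM_eq_integral h).trans ?_
  simp

lemma integrable_testFn_measure (m : Measure (ℝ × ℝ)) [IsFiniteMeasure m] (φ : TestFn) :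
    Integrable φ m :=
  φ.continuous.integrable_of_hasCompactSupport φ.hasCompactSupport

lemma integral_Ioc_snd (φ : TestFn) (s : ℝ) {a b : ℝ} (hab : a ≤ b) :
    ∫ t in Set.Ioc a b, (∂_{((0 : ℝ), (1 : ℝ))} φ) (s, t) = φ (s, b) - φ (s, a) := by
  rw [← intervalIntegral.integral_of_le hab]
  refine intervalIntegral.integral_eq_sub_of_hasDerivAt
    (f := fun t => φ (s, t)) (fun t _ => hasDerivAt_snd φ (s, t)) ?_
  exact ((∂_{((0 : ℝ), (1 : ℝ))} φ).continuous.comp (by fun_prop)).intervalIntegrable _ _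

lemma integral_Ioc_fst (φ : TestFn) (t : ℝ) {a b : ℝ} (hab : a ≤ b) :
    ∫ s in Set.Ioc a b, (∂_{((1 : ℝ), (0 : ℝ))} φ) (s, t) = φ (b, t) - φ (a, t) := by
  rw [← intervalIntegral.integral_of_le hab]
  refine intervalIntegral.integral_eq_sub_of_hasDerivAt
    (f := fun s => φ (s, t)) (fun s _ => hasDerivAt_fst φ (s, t)) ?_
  exact ((∂_{((1 : ℝ), (0 : ℝ))} φ).continuous.comp (by fun_prop)).intervalIntegrable _ _

lemma integral_prod_dirac (m : Measure ℝ) [IsFiniteMeasure m] (φ : TestFn) (a : ℝ) :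
    ∫ x, φ x ∂(m.prod (Measure.dirac a)) = ∫ s, φ (s, a) ∂m := by
  rw [integral_prod _ (integrable_testFn_measure _ φ)]
  simp

lemma integral_dirac_prod (m : Measure ℝ) [IsFiniteMeasure m] (φ : TestFn) (a : ℝ) :
    ∫ x, φ x ∂((Measure.dirac a).prod m) = ∫ t, φ (a, t) ∂m := by
  rw [integral_prod _ (integrable_testFn_measure _ φ)]
  simp

lemma integrable_slice_snd (m : Measure ℝ) [IsFiniteMeasure m] (φ : TestFn) (a : ℝ) :
    Integrable (fun s => φ (s, a)) m := by
  have h := (integrable_testFn_measure (m.prod (Measure.dirac a)) φ).integral_prod_left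
  simpa using h

lemma integrable_slice_fst (m : Measure ℝ) [IsFiniteMeasure m] (φ : TestFn) (a : ℝ) :
    Integrable (fun t => φ (a, t)) m := by
  have h := (integrable_testFn_measure ((Measure.dirac a).prod m) φ).integral_prod_right
  simpa using h

/-- The derivative of an interval's indicator is the Dirac mass at its left end minus that at its
right end, by the fundamental theorem of calculus on each slice. -/
lemma ID_ofMeasure_prod_Ioc (m : Measure ℝ) [IsFiniteMeasure m] {a b : ℝ} (hab : a ≤ b) :
    ID (ofMeasure (m.prod (volume.restrict (Set.Ioc a b)))) =
      ofMeasure (m.prod (Measure.dirac a)) - ofMeasure (m.prod (Measure.dirac b)) := by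
  ext φ
  change _ = ofMeasure (m.prod (Measure.dirac a)) φ - ofMeasure (m.prod (Measure.dirac b)) φ
  rw [ID_apply, ofMeasure_apply, ofMeasure_apply, ofMeasure_apply, integral_prod_dirac,
    integral_prod_dirac, integral_prod _ (integrable_testFn_measure _ _)]
  simp_rw [integral_Ioc_snd φ _ hab]
  rw [integral_sub (integrable_slice_snd m φ b) (integrable_slice_snd m φ a)]
  ring

lemma DI_ofMeasure_Ioc_prod (m : Measure ℝ) [IsFiniteMeasure m] {a b : ℝ} (hab : a ≤ b) :
    DI (ofMeasure ((volume.restrict (Set.Ioc a b)).prod m)) =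
      ofMeasure ((Measure.dirac a).prod m) - ofMeasure ((Measure.dirac b).prod m) := by
  ext φ
  change _ = ofMeasure ((Measure.dirac a).prod m) φ - ofMeasure ((Measure.dirac b).prod m) φ
  rw [DI_apply, ofMeasure_apply, ofMeasure_apply, ofMeasure_apply, integral_dirac_prod,
    integral_dirac_prod, integral_prod_symm _ (integrable_testFn_measure _ _)]
  simp_rw [integral_Ioc_fst φ _ hab]
  rw [integral_sub (integrable_slice_fst m φ b) (integrable_slice_fst m φ a)]
  ring

lemma DI_sum {ι : Type*} (s : Finset ι) (f : ι → Distr) : DI (∑ i ∈ s, f i) = ∑ i ∈ s, DI (f i) := by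
  classical
  induction s using Finset.induction_on with
  | empty => simpa using DI_smul 0 0
  | insert i s hi ih => rw [Finset.sum_insert hi, DI_add, ih, Finset.sum_insert hi]

lemma ID_sum {ι : Type*} (s : Finset ι) (f : ι → Distr) : ID (∑ i ∈ s, f i) = ∑ i ∈ s, ID (f i) := by
  classical
  induction s using Finset.induction_on with
  | empty => simpa using ID_smul 0 0
  | insert i s hi ih => rw [Finset.sum_insert hi, ID_add, ih, Finset.sum_insert hi]

/-- Summation by parts, with vanishing boundary terms. -/
lemma sum_smul_sub_eq {V : Type*} [AddCommGroup V] [Module ℝ V] (c : ℤ → ℝ) (A : ℕ → V) (N : ℕ)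
    (h0 : c (-1) = 0) (hN : c N = 0) :
    ∑ j ∈ Finset.range N, c j • (A j - A (j + 1)) =
      ∑ j ∈ Finset.range (N + 1), (c j - c (j - 1)) • A j := by
  have key : ∀ n : ℕ, ∑ j ∈ Finset.range n, c j • (A j - A (j + 1)) =
      ∑ j ∈ Finset.range (n + 1), (c j - c (j - 1)) • A j - c n • A n := by
    intro n
    induction n with
    | zero => simp [h0]
    | succ n ih =>
      rw [Finset.sum_range_succ, ih, Finset.sum_range_succ _ (n + 1)]
      push_cast
      rw [add_sub_cancel_right]
      module
  rw [key, hN, zero_smul, sub_zero]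

/-! ### The piecewise constant approximation and its derivatives. -/

section Approximation

variable {ε : ℝ} (k : Profile ε) (N : ℕ)

/-- The Lebesgue measure on the `i`-th cell of the subdivision of `[0,1]` into `N` intervals. -/
def cell (i : ℕ) : Measure ℝ := volume.restrict (Set.Ioc ((i : ℝ) / N) (((i + 1 : ℕ) : ℝ) / N))

instance (i : ℕ) : IsFiniteMeasure (cell N i) := by unfold cell; infer_instance

/-- The Dirac measure at the `i`-th node of the subdivision of `[0,1]` into `N` intervals. -/
def node (i : ℕ) : Measure ℝ := Measure.dirac ((i : ℝ) / N)

instance (i : ℕ) : IsProbabilityMeasure (node N i) := by unfold node; infer_instance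

lemma ID_ofMeasure_prod_cell (m : Measure ℝ) [IsFiniteMeasure m] (j : ℕ) :
    ID (ofMeasure (m.prod (cell N j))) =
      ofMeasure (m.prod (node N j)) - ofMeasure (m.prod (node N (j + 1))) :=
  ID_ofMeasure_prod_Ioc m (by gcongr; simp)

lemma DI_ofMeasure_cell_prod (m : Measure ℝ) [IsFiniteMeasure m] (i : ℕ) :
    DI (ofMeasure ((cell N i).prod m)) =
      ofMeasure ((node N i).prod m) - ofMeasure ((node N (i + 1)).prod m) :=
  DI_ofMeasure_Ioc_prod m (by gcongr; simp)

variable [NeZero N]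

/-- The piecewise constant approximation of a distribution by its averages on the cells. -/
def approx (f : Distr) : Distr :=
  ∑ i ∈ Finset.range N, ∑ j ∈ Finset.range N,
    ((N : ℝ) ^ 2 * f (tensor (k.bump N i) (k.bump N j))) • ofMeasure ((cell N i).prod (cell N j))

/-- Differences of Dirac masses are moved onto the coefficients by summation by parts; the
differences of neighbouring bump averages that appear are the values of `ID f` on hats. -/
lemma ID_approx {f : Distr} (hf : VanishesOff f) : ID (approx k N f) =
    ∑ i ∈ Finset.range N, ∑ j ∈ Finset.range (N + 1),
      (N * ID f (tensor (k.bump N i) (k.hat N j))) • ofMeasure ((cell N i).prod (node N j)) := by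
  simp_rw [approx, ID_sum, ID_smul, ID_ofMeasure_prod_cell, ID_tensor_hat]
  refine Finset.sum_congr rfl fun i _ => ?_
  rw [sum_smul_sub_eq (fun j => (N : ℝ) ^ 2 * f (tensor (k.bump N i) (k.bump N j)))
    (fun j => ofMeasure ((cell N i).prod (node N j))) N (by simp [hf.tensor_bump_neg_one k N])
    (by simp [hf.tensor_bump_self k N])]
  refine Finset.sum_congr rfl fun j _ => ?_
  congr 1
  ring

lemma DI_approx {f : Distr} (hf : VanishesOff f) : DI (approx k N f) =
    ∑ j ∈ Finset.range N, ∑ i ∈ Finset.range (N + 1),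
      (N * DI f (tensor (k.hat N i) (k.bump N j))) • ofMeasure ((node N i).prod (cell N j)) := by
  rw [approx, Finset.sum_comm]
  simp_rw [DI_sum, DI_smul, DI_ofMeasure_cell_prod, DI_tensor_hat]
  refine Finset.sum_congr rfl fun j _ => ?_
  rw [sum_smul_sub_eq (fun i => (N : ℝ) ^ 2 * f (tensor (k.bump N i) (k.bump N j)))
    (fun i => ofMeasure ((node N i).prod (cell N j))) N (by simp [hf.bump_neg_one_tensor k N])
    (by simp [hf.bump_self_tensor k N])]
  refine Finset.sum_congr rfl fun i _ => ?_
  congr 1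
  ring

/-- Both directions have been summed by parts, so only atoms at the nodes remain. The outer index is
the second coordinate, which is why later sums over pairs use `p.2` before `p.1`. -/
lemma DD_approx {f : Distr} (hf : VanishesOff f) : DD (approx k N f) =
    ∑ j ∈ Finset.range (N + 1), ∑ i ∈ Finset.range (N + 1),
      DD f (tensor (k.hat N i) (k.hat N j)) • ofMeasure ((node N i).prod (node N j)) := by
  rw [DD, ID_approx k N hf, Finset.sum_comm]
  simp_rw [DI_sum, DI_smul, DI_ofMeasure_cell_prod]
  refine Finset.sum_congr rfl fun j _ => ?_
  rw [sum_smul_sub_eq (fun i => (N : ℝ) * ID f (tensor (k.bump N i) (k.hat N j)))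
    (fun i => ofMeasure ((node N i).prod (node N j))) N (by simp [hf.ID.bump_neg_one_tensor k N])
    (by simp [hf.ID.bump_self_tensor k N])]
  refine Finset.sum_congr rfl fun i _ => ?_
  rw [DD, DI_tensor_hat]
  congr 1
  ring

lemma cell_univ (i : ℕ) : cell N i Set.univ = (N : ℝ≥0∞)⁻¹ := by
  have h3 := Profile.natCast_pos_of_neZero N
  rw [cell, Measure.restrict_apply_univ, Real.volume_Ioc]
  have : ((i + 1 : ℕ) : ℝ) / N - i / N = (N : ℝ)⁻¹ := by push_cast; field_simp; ring
  rw [this, ENNReal.ofReal_inv_of_pos h3, ENNReal.ofReal_natCast]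

lemma cell_compl_Icc {i : ℕ} (hi : i < N) : cell N i (Set.Icc (0 : ℝ) 1)ᶜ = 0 := by
  have h3 := Profile.natCast_pos_of_neZero N
  rw [cell, Measure.restrict_apply measurableSet_Icc.compl]
  convert measure_empty (μ := (volume : Measure ℝ))
  ext t
  simp only [Set.mem_inter_iff, Set.mem_compl_iff, Set.mem_empty_iff_false, iff_false, not_and]
  rintro ht ⟨h1, h2⟩
  refine ht ⟨le_trans (by positivity) h1.le, h2.trans ?_⟩
  rw [div_le_one h3]
  exact_mod_cast hi

lemma node_compl_Icc {i : ℕ} (hi : i < N + 1) : node N i (Set.Icc (0 : ℝ) 1)ᶜ = 0 := by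
  have h3 := Profile.natCast_pos_of_neZero N
  rw [node, Measure.dirac_apply' _ measurableSet_Icc.compl, Set.indicator_of_notMem]
  rw [Set.mem_compl_iff, not_not]
  refine ⟨by positivity, ?_⟩
  rw [div_le_one h3]
  exact_mod_cast Nat.lt_succ_iff.1 hi

lemma prod_compl_unitSquare {m m' : Measure ℝ} [SFinite m] [SFinite m']
    (h : m (Set.Icc (0 : ℝ) 1)ᶜ = 0)
    (h' : m' (Set.Icc (0 : ℝ) 1)ᶜ = 0) : m.prod m' unitSquareᶜ = 0 := by
  rw [unitSquare, Set.compl_prod_eq_union]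
  refine measure_union_null ?_ ?_ <;> rw [Measure.prod_prod]
  · rw [h, zero_mul]
  · rw [h', mul_zero]

end Approximation

/-! ### Total variation of sampled measures. -/

section Norm

variable {ι : Type*} (s : Finset ι) (c : ι → ℝ) (m : ι → Measure (ℝ × ℝ))

instance (σ : SignedMeasure (ℝ × ℝ)) : IsFiniteMeasure σ.variation := by
  rw [← SignedMeasure.totalVariation_eq_variation]
  unfold SignedMeasure.totalVariation
  infer_instance

lemma integral_toSignedMeasure' (m : Measure (ℝ × ℝ)) [IsFiniteMeasure m] (φ : ℝ × ℝ → ℝ) :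
    ∫ᵛ x, φ x ∂•m.toSignedMeasure = ∫ x, φ x ∂m := by
  rw [← VectorMeasure.integral_toSignedMeasure]
  congr 1
  ext; simp

lemma integral_sum_smul_measure [∀ i, IsFiniteMeasure (m i)] {φ : ℝ × ℝ → ℝ}
    (hφ : ∀ i, Integrable φ (m i)) :
    ∫ᵛ x, φ x ∂•(∑ i ∈ s, c i • (m i).toSignedMeasure) = ∑ i ∈ s, c i * ∫ x, φ x ∂(m i) := by
  rw [VectorMeasure.integral_finsetSum_vectorMeasure]
  · refine Finset.sum_congr rfl fun i _ => ?_
    rw [VectorMeasure.integral_smul_vectorMeasure, integral_toSignedMeasure', smul_eq_mul]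
  · intro i _
    refine VectorMeasure.Integrable.smul_vectorMeasure ?_ _
    simpa [VectorMeasure.Integrable] using hφ i

lemma variation_sum_smul_measure_le [∀ i, IsFiniteMeasure (m i)] (A : Set (ℝ × ℝ)) :
    (∑ i ∈ s, c i • (m i).toSignedMeasure).variation A ≤ ∑ i ∈ s, ‖c i‖ₑ * m i A := by
  refine (VectorMeasure.variation_finsetSum_le _ _ A).trans (le_of_eq ?_)
  simp [VectorMeasure.variation_smul, enorm_eq_nnnorm]

lemma isMeasureOn_sum_smul_ofMeasure [∀ i, IsFiniteMeasure (m i)] {S : Set (ℝ × ℝ)}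
    (hS : ∀ i ∈ s, m i Sᶜ = 0) :
    IsMeasureOn S (∑ i ∈ s, c i • ofMeasure (m i)) (∑ i ∈ s, c i • (m i).toSignedMeasure) := by
  refine ⟨le_antisymm ((variation_sum_smul_measure_le s c m _).trans (le_of_eq ?_)) zero_le,
    fun φ => ?_⟩
  · exact Finset.sum_eq_zero fun i hi => by rw [hS i hi, mul_zero]
  · rw [integral_sum_smul_measure _ _ _ fun i => integrable_testFn_measure (m i) φ]
    simp_rw [← ofMeasure_apply]
    rw [_root_.sum_apply]
    rfl

lemma measureNorm_sum_smul_ofMeasure_le [∀ i, IsFiniteMeasure (m i)]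
    (hS : ∀ i ∈ s, m i unitSquareᶜ = 0) :
    measureNorm (∑ i ∈ s, c i • ofMeasure (m i)) ≤ ∑ i ∈ s, ‖c i‖ₑ * m i Set.univ :=
  (iInf₂_le _ (isMeasureOn_sum_smul_ofMeasure s c m hS)).trans
    (variation_sum_smul_measure_le s c m _)

/-- For any measure `σ` representing `T`, each `|T (φ i)|` is at most the integral of `φ i` against
the variation of `σ`, which lives on the square, where the `φ i` sum to at most `C`. -/
lemma sum_enorm_apply_le_measureNorm (T : Distr) (φ : ι → TestFn) {C : ℝ} (hC : 0 < C)
    (hφ : ∀ i ∈ s, ∀ x, 0 ≤ φ i x) (hsum : ∀ x ∈ unitSquare, ∑ i ∈ s, φ i x ≤ C) :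
    ∑ i ∈ s, ‖T (φ i)‖ₑ ≤ ENNReal.ofReal C * measureNorm T := by
  -- A nonzero finite factor passes through the infimum, even when no measure represents `T` and the
  -- infimum is `∞`.
  have hC0 : ENNReal.ofReal C ≠ 0 := by simpa using hC
  rw [measureNorm, ENNReal.mul_iInf_of_ne hC0 ENNReal.ofReal_ne_top]
  refine le_iInf fun σ => ?_
  rw [ENNReal.mul_iInf_of_ne hC0 ENNReal.ofReal_ne_top]
  refine le_iInf fun hσ => ?_
  calc ∑ i ∈ s, ‖T (φ i)‖ₑ ≤ ∑ i ∈ s, ∫⁻ x, ‖φ i x‖ₑ ∂σ.variation := by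
        refine Finset.sum_le_sum fun i _ => ?_
        rw [hσ.2]
        refine VectorMeasure.enorm_integral_le_lintegral_enorm_transpose.trans (le_of_eq ?_)
        rw [VectorMeasure.variation_transpose_lsmul]
    _ = ∫⁻ x, ∑ i ∈ s, ‖φ i x‖ₑ ∂σ.variation := by
        rw [lintegral_finsetSum]
        exact fun i _ => (φ i).continuous.enorm.measurable
    _ ≤ ∫⁻ _, ENNReal.ofReal C ∂σ.variation := by
        refine lintegral_mono_ae ?_
        have : ∀ᵐ x ∂σ.variation, x ∈ unitSquare := hσ.1
        filter_upwards [this] with x hx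
        rw [Finset.sum_congr rfl fun i hi => Real.enorm_of_nonneg (hφ i hi x),
          ← ENNReal.ofReal_sum_of_nonneg fun i hi => hφ i hi x]
        exact ENNReal.ofReal_le_ofReal (hsum x hx)
    _ = ENNReal.ofReal C * σ.variation Set.univ := by rw [lintegral_const]

end Norm

/-! ### Norm bounds for the approximation. -/

section Bounds

variable {ε : ℝ} (k : Profile ε) (N : ℕ) [NeZero N]

lemma bump_nonneg (i : ℤ) (t : ℝ) : 0 ≤ k.bump N i t := k.b_nonneg _

lemma hat_nonneg (i : ℤ) (t : ℝ) : 0 ≤ k.hat N i t := k.h_nonneg _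

lemma sum_tensor_bump_hat_le (hε : 0 ≤ ε) {x : ℝ × ℝ} (hx : x ∈ unitSquare) :
    ∑ p ∈ Finset.range N ×ˢ Finset.range (N + 1), tensor (k.bump N p.1) (k.hat N p.2) x ≤
      1 + ε := by
  simp_rw [tensor_apply]
  rw [Finset.sum_product]
  simp_rw [← Finset.mul_sum]
  rw [k.sum_hat N hx.2]
  simp_rw [mul_one]
  exact k.sum_bump_le N hε _

lemma sum_tensor_hat_bump_le (hε : 0 ≤ ε) {x : ℝ × ℝ} (hx : x ∈ unitSquare) :
    ∑ p ∈ Finset.range N ×ˢ Finset.range (N + 1), tensor (k.hat N p.2) (k.bump N p.1) x ≤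
      1 + ε := by
  simp_rw [tensor_apply]
  rw [Finset.sum_product]
  simp_rw [← Finset.sum_mul]
  rw [k.sum_hat N hx.1]
  simp_rw [one_mul]
  exact k.sum_bump_le N hε _

lemma sum_tensor_hat_hat {x : ℝ × ℝ} (hx : x ∈ unitSquare) :
    ∑ p ∈ Finset.range (N + 1) ×ˢ Finset.range (N + 1), tensor (k.hat N p.2) (k.hat N p.1) x =
      1 := by
  simp_rw [tensor_apply]
  rw [Finset.sum_product]
  simp_rw [← Finset.sum_mul]
  rw [k.sum_hat N hx.1]
  simp_rw [one_mul]
  exact k.sum_hat N hx.2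

lemma enorm_natCast_mul_mul_inv (c : ℝ) : ‖(N : ℝ) * c‖ₑ * (N : ℝ≥0∞)⁻¹ = ‖c‖ₑ := by
  have hN : (N : ℝ≥0∞) ≠ 0 := by simpa using NeZero.ne N
  rw [enorm_mul, Real.enorm_natCast, mul_comm, ← mul_assoc,
    ENNReal.inv_mul_cancel hN (ENNReal.natCast_ne_top N), one_mul]

lemma cell_prod_node_univ (i j : ℕ) :
    (cell N i).prod (node N j) Set.univ = (N : ℝ≥0∞)⁻¹ := by
  rw [← Set.univ_prod_univ, Measure.prod_prod, cell_univ, measure_univ, mul_one]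

lemma node_prod_cell_univ (i j : ℕ) :
    (node N j).prod (cell N i) Set.univ = (N : ℝ≥0∞)⁻¹ := by
  rw [← Set.univ_prod_univ, Measure.prod_prod, cell_univ, measure_univ, one_mul]

lemma measureNorm_ID_approx_le_sum {f : Distr} (hf : VanishesOff f) :
    measureNorm (ID (approx k N f)) ≤
      ∑ p ∈ Finset.range N ×ˢ Finset.range (N + 1),
        ‖ID f (tensor (k.bump N p.1) (k.hat N p.2))‖ₑ := by
  rw [ID_approx k N hf, ← Finset.sum_product']
  refine (measureNorm_sum_smul_ofMeasure_le _ _ _ fun p hp => ?_).trans (le_of_eq ?_)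
  · rw [Finset.mem_product, Finset.mem_range, Finset.mem_range] at hp
    exact prod_compl_unitSquare (cell_compl_Icc N hp.1) (node_compl_Icc N hp.2)
  · simp_rw [cell_prod_node_univ, enorm_natCast_mul_mul_inv]

lemma measureNorm_DI_approx_le_sum {f : Distr} (hf : VanishesOff f) :
    measureNorm (DI (approx k N f)) ≤
      ∑ p ∈ Finset.range N ×ˢ Finset.range (N + 1),
        ‖DI f (tensor (k.hat N p.2) (k.bump N p.1))‖ₑ := by
  rw [DI_approx k N hf, ← Finset.sum_product']
  refine (measureNorm_sum_smul_ofMeasure_le _ _ _ fun p hp => ?_).trans (le_of_eq ?_)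
  · rw [Finset.mem_product, Finset.mem_range, Finset.mem_range] at hp
    exact prod_compl_unitSquare (node_compl_Icc N hp.2) (cell_compl_Icc N hp.1)
  · simp_rw [node_prod_cell_univ, enorm_natCast_mul_mul_inv]

lemma measureNorm_DD_approx_le_sum {f : Distr} (hf : VanishesOff f) :
    measureNorm (DD (approx k N f)) ≤
      ∑ p ∈ Finset.range (N + 1) ×ˢ Finset.range (N + 1),
        ‖DD f (tensor (k.hat N p.2) (k.hat N p.1))‖ₑ := by
  rw [DD_approx k N hf, ← Finset.sum_product']
  refine (measureNorm_sum_smul_ofMeasure_le _ _ _ fun p hp => ?_).trans (le_of_eq ?_)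
  · rw [Finset.mem_product, Finset.mem_range, Finset.mem_range] at hp
    exact prod_compl_unitSquare (node_compl_Icc N hp.2) (node_compl_Icc N hp.1)
  · simp_rw [measure_univ, mul_one]

lemma thetaNorm_approx_le (hε : 0 ≤ ε) (θ : ℝ) {f : Distr} (hf : VanishesOff f) :
    thetaNorm θ (approx k N f) ≤ ENNReal.ofReal (1 + ε) * thetaNorm θ f := by
  have hε' : 0 < 1 + ε := by linarith
  have h1 : measureNorm (ID (approx k N f)) ≤ ENNReal.ofReal (1 + ε) * measureNorm (ID f) :=
    (measureNorm_ID_approx_le_sum k N hf).trans (sum_enorm_apply_le_measureNorm _ _ _ hε'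
      (fun p _ x => mul_nonneg (bump_nonneg k N _ _) (hat_nonneg k N _ _))
      fun x hx => sum_tensor_bump_hat_le k N hε hx)
  have h2 : measureNorm (DI (approx k N f)) ≤ ENNReal.ofReal (1 + ε) * measureNorm (DI f) :=
    (measureNorm_DI_approx_le_sum k N hf).trans (sum_enorm_apply_le_measureNorm _ _ _ hε'
      (fun p _ x => mul_nonneg (hat_nonneg k N _ _) (bump_nonneg k N _ _))
      fun x hx => sum_tensor_hat_bump_le k N hε hx)
  have h3 : measureNorm (DD (approx k N f)) ≤ ENNReal.ofReal (1 + ε) * measureNorm (DD f) :=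
    (measureNorm_DD_approx_le_sum k N hf).trans (sum_enorm_apply_le_measureNorm _ _ _ hε'
      (fun p _ x => mul_nonneg (hat_nonneg k N _ _) (hat_nonneg k N _ _))
      fun x hx => (sum_tensor_hat_hat k N hx).le.trans (by linarith))
  calc thetaNorm θ (approx k N f)
      ≤ ENNReal.ofReal θ * (ENNReal.ofReal (1 + ε) * measureNorm (DD f)) +
        ENNReal.ofReal (1 - θ) * (ENNReal.ofReal (1 + ε) * measureNorm (ID f) +
          ENNReal.ofReal (1 + ε) * measureNorm (DI f)) := by
        unfold thetaNorm; gcongr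
    _ = ENNReal.ofReal (1 + ε) * thetaNorm θ f := by unfold thetaNorm; ring

/-- Finiteness comes from the finite sums themselves, so nothing is asked of the norm of `f`. -/
lemma thetaNorm_approx_ne_top (θ : ℝ) {f : Distr} (hf : VanishesOff f) :
    thetaNorm θ (approx k N f) ≠ ∞ := by
  have hfin {ι : Type} (s : Finset ι) (g : ι → ℝ) : ∑ i ∈ s, ‖g i‖ₑ ≠ ∞ := by simp
  have h1 := ne_top_of_le_ne_top (hfin _ _) (measureNorm_ID_approx_le_sum k N hf)
  have h2 := ne_top_of_le_ne_top (hfin _ _) (measureNorm_DI_approx_le_sum k N hf)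
  have h3 := ne_top_of_le_ne_top (hfin _ _) (measureNorm_DD_approx_le_sum k N hf)
  unfold thetaNorm
  finiteness

end Bounds

/-! ### Quasi-interpolation of `C₀` functions. -/

section Interpolation

variable {ε : ℝ} (k : Profile ε) (N : ℕ) [NeZero N]

/-- The `(i, j)`-th point of the uniform grid with `N` subdivisions. -/
def gridPoint (p : ℕ × ℕ) : ℝ × ℝ := ((p.2 : ℝ) / N, (p.1 : ℝ) / N)

/-- The smooth quasi-interpolant of a function at the points of the grid. -/
def interp (φ : ℝ × ℝ → ℝ) : TestFn :=
  ∑ p ∈ Finset.range (N + 1) ×ˢ Finset.range (N + 1),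
    φ (gridPoint N p) • tensor (k.hat N p.2) (k.hat N p.1)

lemma interp_apply (φ : ℝ × ℝ → ℝ) (x : ℝ × ℝ) :
    interp k N φ x = ∑ p ∈ Finset.range (N + 1) ×ˢ Finset.range (N + 1),
      φ (gridPoint N p) * tensor (k.hat N p.2) (k.hat N p.1) x := by
  rw [interp, _root_.sum_apply]
  rfl

lemma abs_sub_div_le_of_hat_ne_zero {i : ℕ} {t : ℝ} (h : k.hat N i t ≠ 0) :
    |t - i / N| ≤ 1 / N := by
  have h1 := k.h_supp _ h
  have h3 := Profile.natCast_pos_of_neZero N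
  have h4 : t - i / N = (N * t - (i : ℤ)) / N := by push_cast; field_simp
  rw [h4, abs_div, abs_of_pos h3]
  gcongr

/-- On the square the interpolant at `x` is a convex combination of values of `φ` at nodes within `1
/ N` of `x` in the sup metric. -/
lemma abs_interp_sub_le {φ : ℝ × ℝ → ℝ} {δ : ℝ}
    (hδ : ∀ x z, dist x z ≤ 1 / N → |φ x - φ z| ≤ δ) {x : ℝ × ℝ} (hx : x ∈ unitSquare) :
    |interp k N φ x - φ x| ≤ δ := by
  have h1 := sum_tensor_hat_hat k N hx
  have hnn : ∀ p : ℕ × ℕ, 0 ≤ tensor (k.hat N p.2) (k.hat N p.1) x := fun p =>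
    mul_nonneg (hat_nonneg k N _ _) (hat_nonneg k N _ _)
  calc |interp k N φ x - φ x|
      = |∑ p ∈ Finset.range (N + 1) ×ˢ Finset.range (N + 1),
          (φ (gridPoint N p) - φ x) * tensor (k.hat N p.2) (k.hat N p.1) x| := by
        simp_rw [sub_mul]
        rw [Finset.sum_sub_distrib, ← Finset.mul_sum, h1, mul_one, interp_apply]
    _ ≤ ∑ p ∈ Finset.range (N + 1) ×ˢ Finset.range (N + 1),
          δ * tensor (k.hat N p.2) (k.hat N p.1) x := by
        refine (Finset.abs_sum_le_sum_abs _ _).trans (Finset.sum_le_sum fun p _ => ?_)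
        rw [abs_mul, abs_of_nonneg (hnn p)]
        by_cases h0 : tensor (k.hat N p.2) (k.hat N p.1) x = 0
        · rw [h0, mul_zero, mul_zero]
        · refine mul_le_mul_of_nonneg_right (hδ _ _ ?_) (hnn p)
          rw [tensor_apply] at h0
          rw [dist_comm, Prod.dist_eq, Real.dist_eq, Real.dist_eq]
          exact max_le (abs_sub_div_le_of_hat_ne_zero k N (left_ne_zero_of_mul h0))
            (abs_sub_div_le_of_hat_ne_zero k N (right_ne_zero_of_mul h0))
    _ = δ := by rw [← Finset.mul_sum, h1, mul_one]

lemma integrable_zeroAtInfty (m : Measure (ℝ × ℝ)) [IsFiniteMeasure m] (φ : C₀(ℝ × ℝ, ℝ)) :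
    Integrable φ m :=
  φ.toBCF.integrable m

lemma tendsto_apply_interp {T : Distr} {σ : SignedMeasure (ℝ × ℝ)}
    (hσ : IsMeasureOn unitSquare T σ) (φ : C₀(ℝ × ℝ, ℝ)) {ε : ℕ → ℝ} (k : ∀ n, Profile (ε n)) :
    Tendsto (fun n => T (interp (k n) (2 ^ n) φ)) atTop (𝓝 (∫ᵛ x, φ x ∂•σ)) := by
  rw [Metric.tendsto_atTop]
  intro η hη
  set V := σ.variation.real Set.univ
  have hV : 0 ≤ V := measureReal_nonneg
  have huc : UniformContinuous φ := ZeroAtInftyContinuousMap.uniformContinuous φ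
  -- Dividing by `V + 1` covers `V = 0` and makes the final bound strict.
  obtain ⟨r, hr, hφ⟩ := Metric.uniformContinuous_iff.1 huc (η / (V + 1)) (by positivity)
  obtain ⟨n₀, hn₀⟩ := exists_pow_lt_of_lt_one hr (show (1 / 2 : ℝ) < 1 by norm_num)
  refine ⟨n₀, fun n hn => ?_⟩
  have hn' : (1 : ℝ) / (2 ^ n : ℕ) < r := by
    push_cast
    rw [← one_div_pow]
    exact (pow_le_pow_of_le_one (by norm_num) (by norm_num) hn).trans_lt hn₀
  rw [hσ.2, dist_eq_norm, ← VectorMeasure.integral_fun_sub (integrable_testFn _ _)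
    (integrable_zeroAtInfty _ _)]
  have hae : ∀ᵐ x ∂σ.variation, ‖interp (k n) (2 ^ n) φ x - φ x‖ ≤ η / (V + 1) := by
    have : ∀ᵐ x ∂σ.variation, x ∈ unitSquare := hσ.1
    filter_upwards [this] with x hx
    refine abs_interp_sub_le (k n) (2 ^ n) (fun x z hxz => ?_) hx
    exact (hφ (hxz.trans_lt hn')).le
  refine (VectorMeasure.norm_integral_le_of_norm_le_const hae).trans_lt ?_
  have hB : ‖(ContinuousLinearMap.lsmul ℝ ℝ : ℝ →L[ℝ] ℝ →L[ℝ] ℝ)‖ ≤ 1 :=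
    ContinuousLinearMap.opNorm_lsmul_le
  calc η / (V + 1) * ‖(ContinuousLinearMap.lsmul ℝ ℝ : ℝ →L[ℝ] ℝ →L[ℝ] ℝ)‖ * V
      ≤ η / (V + 1) * 1 * V := by gcongr
    _ < η := by
      rw [mul_one, div_mul_eq_mul_div, div_lt_iff₀ (by positivity)]
      nlinarith

/-- Both integrals are the limit of the same numbers `T (interp φ)`. Hence `predualPairing` does not
depend on the measure chosen in `mixedMeasure`. -/
lemma IsMeasureOn.integral_eq {T : Distr} {σ τ : SignedMeasure (ℝ × ℝ)}
    (hσ : IsMeasureOn unitSquare T σ) (hτ : IsMeasureOn unitSquare T τ) (φ : C₀(ℝ × ℝ, ℝ)) :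
    ∫ᵛ x, φ x ∂•σ = ∫ᵛ x, φ x ∂•τ := by
  obtain ⟨k⟩ := Profile.exists one_pos
  exact tendsto_nhds_unique (tendsto_apply_interp hσ φ fun _ => k)
    (tendsto_apply_interp hτ φ fun _ => k)

end Interpolation

/-! ### Approximation inside the positive cone and weak-* convergence. -/

section Cone

variable {ε : ℝ} (k : Profile ε) (N : ℕ) [NeZero N]

/-- The mixed derivative of the approximation, as a measure on the grid. -/
def approxMeasure (f : Distr) : SignedMeasure (ℝ × ℝ) :=
  ∑ p ∈ Finset.range (N + 1) ×ˢ Finset.range (N + 1),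
    DD f (tensor (k.hat N p.2) (k.hat N p.1)) •
      ((node N p.2).prod (node N p.1)).toSignedMeasure

lemma isMeasureOn_approxMeasure {f : Distr} (hf : VanishesOff f) {S : Set (ℝ × ℝ)}
    (hS : ∀ p ∈ Finset.range (N + 1) ×ˢ Finset.range (N + 1),
      (node N p.2).prod (node N p.1) Sᶜ = 0) :
    IsMeasureOn S (DD (approx k N f)) (approxMeasure k N f) := by
  rw [DD_approx k N hf, ← Finset.sum_product']
  exact isMeasureOn_sum_smul_ofMeasure _ _ _ hS

lemma isMeasureOn_unitSquare_approxMeasure {f : Distr} (hf : VanishesOff f) :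
    IsMeasureOn unitSquare (DD (approx k N f)) (approxMeasure k N f) := by
  refine isMeasureOn_approxMeasure k N hf fun p hp => ?_
  rw [Finset.mem_product, Finset.mem_range, Finset.mem_range] at hp
  exact prod_compl_unitSquare (node_compl_Icc N hp.2) (node_compl_Icc N hp.1)

lemma isMeasureOn_dyadicGrid_approxMeasure (n : ℕ) {f : Distr} (hf : VanishesOff f) :
    IsMeasureOn (dyadicGrid n) (DD (approx k (2 ^ n) f)) (approxMeasure k (2 ^ n) f) := by
  refine isMeasureOn_approxMeasure k (2 ^ n) hf fun p hp => ?_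
  rw [Finset.mem_product, Finset.mem_range, Finset.mem_range] at hp
  rw [node, node, Measure.dirac_prod_dirac, Measure.dirac_apply, Set.indicator_of_notMem]
  rw [Set.mem_compl_iff, not_not]
  exact ⟨p.2, p.1, by omega, by omega, by push_cast; rfl⟩

/-- Sampling the measure against hats is dual to interpolating the function with them. -/
lemma integral_approxMeasure (f : Distr) (φ : C₀(ℝ × ℝ, ℝ)) :
    ∫ᵛ x, φ x ∂•(approxMeasure k N f) = DD f (interp k N φ) := by
  rw [approxMeasure, integral_sum_smul_measure _ _ _ fun p => integrable_zeroAtInfty _ φ, interp,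
    map_sum]
  refine Finset.sum_congr rfl fun p _ => ?_
  rw [map_smul, node, node, Measure.dirac_prod_dirac, integral_dirac, smul_eq_mul, mul_comm]
  rfl

lemma approx_apply (f : Distr) (φ : TestFn) : approx k N f φ =
    ∑ i ∈ Finset.range N, ∑ j ∈ Finset.range N,
      ((N : ℝ) ^ 2 * f (tensor (k.bump N i) (k.bump N j))) *
        ∫ x, φ x ∂((cell N i).prod (cell N j)) := by
  simp_rw [← ofMeasure_apply]
  rw [approx, _root_.sum_apply]
  refine Finset.sum_congr rfl fun i _ => ?_
  rw [_root_.sum_apply]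
  rfl

lemma vanishesOff_approx (f : Distr) : VanishesOff (approx k N f) := by
  intro φ hφ
  rw [approx_apply]
  refine Finset.sum_eq_zero fun i hi => Finset.sum_eq_zero fun j hj => ?_
  rw [Finset.mem_range] at hi hj
  rw [integral_eq_zero_of_ae, mul_zero]
  have : ∀ᵐ x ∂((cell N i).prod (cell N j)), x ∈ unitSquare :=
    prod_compl_unitSquare (cell_compl_Icc N hi) (cell_compl_Icc N hj)
  filter_upwards [this] with x hx
  exact image_eq_zero_of_notMem_tsupport fun h => hφ h hx

/-- The approximation of an element of the positive cone. -/
def coneApprox (f : positiveCone) : positiveCone :=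
  ⟨⟨approx k N (f : nativeSpace),
    ⟨_, isMeasureOn_unitSquare_approxMeasure k N f.1.2.2⟩, vanishesOff_approx k N _⟩, by
      intro φ hφ
      change 0 ≤ approx k N (f : nativeSpace) φ
      rw [approx_apply]
      refine Finset.sum_nonneg fun i _ => Finset.sum_nonneg fun j _ => ?_
      -- Positivity survives because each coefficient is `f` evaluated on a nonnegative bump.
      refine mul_nonneg (mul_nonneg (by positivity) (f.2 _ fun x => ?_)) (integral_nonneg hφ)
      exact mul_nonneg (bump_nonneg k N _ _) (bump_nonneg k N _ _)⟩

lemma coneApprox_mem_gridCone (n : ℕ) (f : positiveCone) :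
    coneApprox k (2 ^ n) f ∈ gridCone n :=
  ⟨_, isMeasureOn_dyadicGrid_approxMeasure k n f.1.2.2⟩

lemma predualPairing_coneApprox (f : positiveCone) (φ : C₀(ℝ × ℝ, ℝ)) :
    predualPairing (coneApprox k N f) φ = DD (f : nativeSpace) (interp k N φ) := by
  rw [← integral_approxMeasure]
  exact IsMeasureOn.integral_eq (coneApprox k N f).1.2.1.choose_spec
    (isMeasureOn_unitSquare_approxMeasure k N f.1.2.2) φ

lemma tendsto_predualPairing_coneApprox (f : positiveCone) {ε : ℕ → ℝ}
    (k : ∀ n, Profile (ε n)) (φ : C₀(ℝ × ℝ, ℝ)) :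
    Tendsto (fun n => predualPairing (coneApprox (k n) (2 ^ n) f) φ) atTop
      (𝓝 (predualPairing f φ)) := by
  simp_rw [predualPairing_coneApprox]
  exact tendsto_apply_interp f.1.2.1.choose_spec φ k

lemma WeakStarContinuous.tendsto_coneApprox {Y : Type*} [TopologicalSpace Y] {g : positiveCone → Y}
    (hg : WeakStarContinuous g) (f : positiveCone) {ε : ℕ → ℝ} (k : ∀ n, Profile (ε n)) :
    Tendsto (fun n => g (coneApprox (k n) (2 ^ n) f)) atTop (𝓝 (g f)) := by
  let t : TopologicalSpace positiveCone :=
    TopologicalSpace.induced (fun f : positiveCone => predualPairing f) Pi.topologicalSpace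
  have hg' : Continuous[t, inferInstance] g := by
    rw [WeakStarContinuous, weakStarTopology, induced_compose] at hg
    exact hg
  refine (@Continuous.tendsto _ _ t _ g hg' f).comp ?_
  rw [nhds_induced, tendsto_comap_iff, tendsto_pi_nhds]
  exact fun φ => tendsto_predualPairing_coneApprox f k φ

end Cone

/-! ### Convexity of the norm. -/

section Convexity

lemma measureNorm_add_le (T U : Distr) : measureNorm (T + U) ≤ measureNorm T + measureNorm U := by
  rw [measureNorm, measureNorm, measureNorm]
  refine ENNReal.le_iInf₂_add_iInf₂ fun σ hσ τ hτ => ?_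
  exact (iInf₂_le _ (hσ.add hτ)).trans (VectorMeasure.variation_add_le _)

lemma measureNorm_smul_le {c : ℝ} (hc : 0 < c) (T : Distr) :
    measureNorm (c • T) ≤ ENNReal.ofReal c * measureNorm T := by
  have hC0 : ENNReal.ofReal c ≠ 0 := by simpa using hc
  conv_rhs => rw [measureNorm, ENNReal.mul_iInf_of_ne hC0 ENNReal.ofReal_ne_top]
  refine le_iInf fun σ => ?_
  rw [ENNReal.mul_iInf_of_ne hC0 ENNReal.ofReal_ne_top]
  refine le_iInf fun hσ => (iInf₂_le _ (hσ.smul c)).trans (le_of_eq ?_)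
  rw [VectorMeasure.variation_smul, Measure.smul_apply, ← Real.enorm_of_nonneg hc.le]
  rfl

lemma thetaNorm_add_le (θ : ℝ) (f g : Distr) :
    thetaNorm θ (f + g) ≤ thetaNorm θ f + thetaNorm θ g := by
  calc thetaNorm θ (f + g)
      ≤ ENNReal.ofReal θ * (measureNorm (DD f) + measureNorm (DD g)) +
        ENNReal.ofReal (1 - θ) * ((measureNorm (ID f) + measureNorm (ID g)) +
          (measureNorm (DI f) + measureNorm (DI g))) := by
        unfold thetaNorm
        rw [DD_add, ID_add, DI_add]
        gcongr <;> exact measureNorm_add_le _ _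
    _ = thetaNorm θ f + thetaNorm θ g := by unfold thetaNorm; ring

lemma thetaNorm_smul_le (θ : ℝ) {c : ℝ} (hc : 0 < c) (f : Distr) :
    thetaNorm θ (c • f) ≤ ENNReal.ofReal c * thetaNorm θ f := by
  calc thetaNorm θ (c • f)
      ≤ ENNReal.ofReal θ * (ENNReal.ofReal c * measureNorm (DD f)) +
        ENNReal.ofReal (1 - θ) * (ENNReal.ofReal c * measureNorm (ID f) +
          ENNReal.ofReal c * measureNorm (DI f)) := by
        unfold thetaNorm
        rw [DD_smul, ID_smul, DI_smul]
        gcongr <;> exact measureNorm_smul_le hc _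
    _ = ENNReal.ofReal c * thetaNorm θ f := by unfold thetaNorm; ring

/-- The midpoint of two elements of the positive cone. -/
def midpoint (f g : positiveCone) : positiveCone := (2⁻¹ : ℝ≥0) • f + (2⁻¹ : ℝ≥0) • g

lemma thetaNorm_midpoint_le (θ : ℝ) (f g : positiveCone) :
    thetaNorm θ (midpoint f g : nativeSpace) ≤
      2⁻¹ * thetaNorm θ (f : nativeSpace) + 2⁻¹ * thetaNorm θ (g : nativeSpace) := by
  have h2 : ENNReal.ofReal (2⁻¹ : ℝ) = 2⁻¹ := by
    rw [ENNReal.ofReal_inv_of_pos two_pos, ENNReal.ofReal_ofNat]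
  have h : ((midpoint f g : nativeSpace) : Distr) =
      (2⁻¹ : ℝ) • ((f : nativeSpace) : Distr) + (2⁻¹ : ℝ) • ((g : nativeSpace) : Distr) := rfl
  rw [h, ← h2]
  refine (thetaNorm_add_le _ _ _).trans ?_
  gcongr <;> exact thetaNorm_smul_le θ (by norm_num) _

end Convexity

/-! ### Minimisers and minimising sequences. -/

section Minimisers

variable {M : ℕ} {E : EuclideanSpace ℝ (Fin M) → EuclideanSpace ℝ (Fin M) → ℝ≥0∞}
  {y : EuclideanSpace ℝ (Fin M)} {ν : positiveCone →ₗ[ℝ≥0] EuclideanSpace ℝ (Fin M)} {lam θ : ℝ}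

lemma map_midpoint (f g : positiveCone) :
    ν (midpoint f g) = (1 / 2 : ℝ) • ν f + (1 - 1 / 2 : ℝ) • ν g := by
  rw [midpoint, map_add, map_smul, map_smul]
  have : (1 - 1 / 2 : ℝ) = 2⁻¹ := by norm_num
  rw [this, one_div]
  rfl

/-- This is convexity of the norm term alone, with the fidelity terms moved across so that no
subtraction occurs in `[0, ∞]`. -/
lemma loss_midpoint_le (f g : positiveCone) :
    loss E y ν lam θ (midpoint f g) + (2⁻¹ * E y (ν f) + 2⁻¹ * E y (ν g)) ≤
      E y ((1 / 2 : ℝ) • ν f + (1 - 1 / 2 : ℝ) • ν g) +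
        (2⁻¹ * loss E y ν lam θ f + 2⁻¹ * loss E y ν lam θ g) := by
  unfold loss
  rw [map_midpoint]
  calc _ ≤ E y ((1 / 2 : ℝ) • ν f + (1 - 1 / 2 : ℝ) • ν g) + ENNReal.ofReal lam *
        (2⁻¹ * thetaNorm θ (f : nativeSpace) + 2⁻¹ * thetaNorm θ (g : nativeSpace)) +
        (2⁻¹ * E y (ν f) + 2⁻¹ * E y (ν g)) := by
        gcongr; exact thetaNorm_midpoint_le θ f g
    _ = _ := by ring

/-- Properness bounds only the fidelity at some `g`. An approximant of `g` has finite norm and, by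
continuity, eventually finite fidelity, so it is a competitor of finite loss. -/
lemma loss_minimiser_ne_top (hEcont : Continuous (E y))
    (hproper : ∃ f : positiveCone, E y (ν f) ≠ ∞) (hν : WeakStarContinuous ν)
    {f : positiveCone} (hf : f ∈ argmin (loss E y ν lam θ) Set.univ) :
    loss E y ν lam θ f ≠ ∞ := by
  obtain ⟨g, hg⟩ := hproper
  obtain ⟨k⟩ := Profile.exists one_pos
  have h1 := (hEcont.tendsto (ν g)).comp (hν.tendsto_coneApprox g fun _ => k)
  obtain ⟨n, hn⟩ := (h1.eventually_lt_const (lt_top_iff_ne_top.2 hg)).exists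
  refine ne_top_of_le_ne_top ?_ (hf.2 (coneApprox k (2 ^ n) g) trivial)
  exact ENNReal.add_ne_top.2 ⟨hn.ne, ENNReal.mul_ne_top ENNReal.ofReal_ne_top
    (thetaNorm_approx_ne_top k (2 ^ n) θ g.1.2.2)⟩

lemma tendsto_loss_of_mem_argmin (hEcont : Continuous (E y)) (hν : WeakStarContinuous ν)
    {fn : ℕ → positiveCone} {f : positiveCone}
    (hfn : ∀ n : ℕ, 1 ≤ n → fn n ∈ argmin (loss E y ν lam θ) (gridCone n))
    (hf : f ∈ argmin (loss E y ν lam θ) Set.univ) :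
    Tendsto (fun n => loss E y ν lam θ (fn n)) atTop (𝓝 (loss E y ν lam θ f)) := by
  have k (n : ℕ) : Profile (1 / ((n : ℝ) + 1)) := (Profile.exists (by positivity)).some
  have hE := (hEcont.tendsto (ν f)).comp (hν.tendsto_coneApprox f k)
  have hc : Tendsto (fun n : ℕ => ENNReal.ofReal (1 + 1 / ((n : ℝ) + 1))) atTop (𝓝 1) := by
    have := ENNReal.tendsto_ofReal ((tendsto_one_div_add_atTop_nhds_zero_nat (𝕜 := ℝ)).const_add 1)
    simpa using this
  have hlim : Tendsto (fun n : ℕ => E y (ν (coneApprox (k n) (2 ^ n) f)) +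
      ENNReal.ofReal (1 + 1 / ((n : ℝ) + 1)) *
        (ENNReal.ofReal lam * thetaNorm θ (f : nativeSpace))) atTop
      (𝓝 (loss E y ν lam θ f)) := by
    -- The factors tend to `1 ≠ 0`, so the product converges even if the norm term is infinite.
    have := hE.add (ENNReal.Tendsto.mul_const
      (b := ENNReal.ofReal lam * thetaNorm θ (f : nativeSpace)) hc (Or.inl one_ne_zero))
    rw [one_mul] at this
    exact this
  -- Squeeze: below by minimality of `f` over the whole cone, above by the approximants of `f`,
  -- which compete on the grid.
  refine tendsto_of_tendsto_of_tendsto_of_le_of_le' tendsto_const_nhds hlim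
    (Eventually.of_forall fun n => hf.2 _ trivial) ?_
  filter_upwards [eventually_ge_atTop 1] with n hn
  refine ((hfn n hn).2 _ (coneApprox_mem_gridCone (k n) n f)).trans ?_
  unfold loss
  refine add_le_add_right ?_ _
  rw [mul_left_comm]
  gcongr
  exact thetaNorm_approx_le (k n) (2 ^ n) (by positivity) θ f.1.2.2

lemma Coercive.isBounded_sublevel {V : Type*} [NormedAddCommGroup V] {g : V → ℝ≥0∞}
    (hg : Coercive g) {C : ℝ≥0∞} (hC : C < ∞) : Bornology.IsBounded {z | g z < C} := by
  have h : ∀ᶠ z in comap norm atTop, C < g z := hg.eventually_const_lt hC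
  rw [comap_norm_atTop] at h
  have h' : Bornology.IsBounded {z | C < g z}ᶜ := by
    rw [Bornology.isBounded_def, compl_compl]
    exact h
  refine h'.subset fun z hz => ?_
  rw [Set.mem_ofPred_eq] at hz
  rw [Set.mem_compl_iff, Set.mem_ofPred_eq, not_lt]
  exact hz.le

lemma eq_of_tendsto_minimising (hEcont : Continuous (E y)) (hEconv : StrictlyConvex (E y))
    {g : ℕ → positiveCone} {f : positiveCone} {z : EuclideanSpace ℝ (Fin M)}
    (hf : f ∈ argmin (loss E y ν lam θ) Set.univ) (hfin : loss E y ν lam θ f ≠ ∞)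
    (hg : Tendsto (fun n => loss E y ν lam θ (g n)) atTop (𝓝 (loss E y ν lam θ f)))
    (hz : Tendsto (fun n => ν (g n)) atTop (𝓝 z)) : z = ν f := by
  by_contra hne
  have hEz : Tendsto (fun n => E y (ν (g n))) atTop (𝓝 (E y z)) := (hEcont.tendsto z).comp hz
  have h1 : E y z ≠ ∞ :=
    ne_top_of_le_ne_top hfin (le_of_tendsto_of_tendsto' hEz hg fun n => le_self_add)
  have h2 : E y (ν f) ≠ ∞ := ne_top_of_le_ne_top hfin le_self_add
  have hhalf : (2⁻¹ : ℝ≥0∞) ≠ ∞ := by simp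
  have hlt := hEconv z (ν f) hne h1 h2 (1 / 2) (by norm_num) (by norm_num)
  have hh : ENNReal.ofReal (1 / 2) = 2⁻¹ := by
    rw [one_div, ENNReal.ofReal_inv_of_pos two_pos, ENNReal.ofReal_ofNat]
  have hh' : ENNReal.ofReal (1 - 1 / 2) = 2⁻¹ := by rw [← hh]; norm_num
  rw [hh, hh'] at hlt
  have hmid : Tendsto (fun n => E y ((1 / 2 : ℝ) • ν (g n) + (1 - 1 / 2 : ℝ) • ν f)) atTop
      (𝓝 (E y ((1 / 2 : ℝ) • z + (1 - 1 / 2 : ℝ) • ν f))) :=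
    (hEcont.tendsto _).comp ((hz.const_smul _).add_const _)
  -- In the limit of the midpoint inequality, the minimal loss stands on both sides. Cancelling it,
  -- as it is finite, leaves the mean of `E y z` and `E y (ν f)` at most the value of `E y` at their
  -- midpoint, against strict convexity.
  have hlim := le_of_tendsto_of_tendsto'
    ((tendsto_const_nhds (x := loss E y ν lam θ f)).add
      ((ENNReal.Tendsto.const_mul hEz (Or.inr hhalf)).add_const (2⁻¹ * E y (ν f))))
    (hmid.add ((ENNReal.Tendsto.const_mul hg (Or.inr hhalf)).add_const
      (2⁻¹ * loss E y ν lam θ f)))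
    fun n => (add_le_add_left (hf.2 (midpoint (g n) f) trivial) _).trans (loss_midpoint_le (g n) f)
  rw [← add_mul, ENNReal.inv_two_add_inv_two, one_mul, add_comm] at hlim
  exact hlt.not_ge ((ENNReal.add_le_add_iff_right hfin).1 hlim)

end Minimisers

end MixedDeriv

end

theorem mainTheorem6 {M : ℕ}
    (E : EuclideanSpace ℝ (Fin M) → EuclideanSpace ℝ (Fin M) → ℝ≥0∞)
    (y : EuclideanSpace ℝ (Fin M))
    (ν : MixedDeriv.positiveCone →ₗ[ℝ≥0] EuclideanSpace ℝ (Fin M))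
    (lam θ : ℝ) (hlam : 0 < lam) (hθ0 : 0 < θ) (hθ1 : θ ≤ 1)
    (hEcont : Continuous (E y))
    (hEcoer : MixedDeriv.Coercive (E y))
    (hEconv : MixedDeriv.StrictlyConvex (E y))
    (hproper : ∃ f : MixedDeriv.positiveCone, E y (ν f) ≠ ∞)
    (hν : MixedDeriv.WeakStarContinuous ν)
    (fn : ℕ → MixedDeriv.positiveCone) (fstar : MixedDeriv.positiveCone)
    (hfn : ∀ n : ℕ, 1 ≤ n →
      fn n ∈ MixedDeriv.argmin (MixedDeriv.loss E y ν lam θ) (MixedDeriv.gridCone n))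
    (hfstar : fstar ∈ MixedDeriv.argmin (MixedDeriv.loss E y ν lam θ) Set.univ) :
    Tendsto (fun n => MixedDeriv.loss E y ν lam θ (fn n)) atTop
        (𝓝 (MixedDeriv.loss E y ν lam θ fstar)) ∧
      Tendsto (fun n => ν (fn n)) atTop (𝓝 (ν fstar)) := by

  have hfin := MixedDeriv.loss_minimiser_ne_top (lam := lam) (θ := θ) hEcont hproper hν hfstar
  have hloss := MixedDeriv.tendsto_loss_of_mem_argmin hEcont hν hfn hfstar
  refine ⟨hloss, tendsto_of_subseq_tendsto fun ns hns => ?_⟩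
  have hsub := hloss.comp hns
  -- Any finite level strictly above the minimum would do: eventually the fidelities lie below it,
  -- in a bounded sublevel set.
  have hlt : MixedDeriv.loss E y ν lam θ fstar < MixedDeriv.loss E y ν lam θ fstar + 1 :=
    ENNReal.lt_add_right hfin one_ne_zero
  have hC : MixedDeriv.loss E y ν lam θ fstar + 1 < ∞ := by finiteness
  have hev : ∀ᶠ n in atTop, ν (fn (ns n)) ∈
      {z | E y z < MixedDeriv.loss E y ν lam θ fstar + 1} := by
    filter_upwards [hsub.eventually_lt_const hlt] with n hn
    exact lt_of_le_of_lt le_self_add hn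
  obtain ⟨z, -, ms, hms, hz⟩ := tendsto_subseq_of_frequently_bounded
    (hEcoer.isBounded_sublevel hC) hev.frequently
  refine ⟨ms, ?_⟩
  rw [← MixedDeriv.eq_of_tendsto_minimising (lam := lam) (θ := θ) (g := fun n => fn (ns (ms n)))
    hEcont hEconv hfstar hfin (hsub.comp hms.tendsto_atTop) hz]
  exact hz
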